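/- Let $\mathbb{Z}[t,t^{-1}]$ be the ring of Laurent polynomials in one variable with integer coefficients, and let $SL_2(\mathbb{Z}[t,t^{-1}])$ be the group of $2\times 2$ matrices of determinant $1$ over this ring. Then the second integral homology group $H_2(SL_2(\mathbb{Z}[t,t^{-1}]);\mathbb{Z})$ (group homology with trivial coefficients $\mathbb{Z}$) is not finitely generated as an abelian group. -/

import Mathlib

/-!
The upper unitriangular matrices of `G = SL₂(ℤ[t, t⁻¹])` commute, so each pair with entries `1` and
`tⁿ`, `n ≥ 1`, spans a torus class in `H₂(G; ℤ)`. Their images in `H₂(SL₂(𝔽₂[t, t⁻¹]); ℤ)`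
already generate a subgroup that is not finitely generated. They are detected by a central extension
of `SL₂(𝔽₂[t, t⁻¹])` by `A = 𝔽₂^ℕ`: its cocycle gives a homomorphism `H₂ → A` which sends the torus
class of a commuting pair to the commutator of lifts of the pair (`IsCentralExtension.not_fg_H2`),
and in the extension the commutator of the lifts of the matrices with entries `1` and `tⁿ⁺¹` is the
`n`-th unit vector. As `A` has exponent two, a finitely generated group has finite image in it.

The extension exists because `SL₂(𝔽₂[t, t⁻¹])` is an iterated amalgam in which the relation saying
that the unitriangular matrices commute can be altered freely. Acting on the two trees of the places
`0` and `∞`, one finds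
* `SL₂(𝔽₂[t]) = SL₂(𝔽₂) *_{𝔽₂} 𝔽₂[t]`, with `𝔽₂[t]` the upper unitriangular group,
* `Γ = 𝔽₂[t] * 𝔽₂[t]`, for the subgroup `Γ` of `SL₂(𝔽₂[t])` of matrices that are upper triangular
  modulo `t`, with upper and lower unitriangular factors,
* `SL₂(𝔽₂[t, t⁻¹]) = SL₂(𝔽₂[t]) *_Γ SL₂(𝔽₂[t])`.

Every copy of `𝔽₂[t]` is replaced by the Heisenberg group `Heis`, whose cocycle
`(f, g) ↦ (∑ᵢ fᵢ gᵢ₊ₙ₊₁)ₙ` is invariant under multiplication by `t`, so that the two embeddings of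
`Γ` still match, and vanishes on constants, so that the group can be glued to `SL₂(𝔽₂)`. Compatible
central extensions of the pieces of an amalgam glue to a central extension of the amalgam
(`IsCentralExtension.amalgam`). The three decompositions are proved by a ping-pong criterion on
reduced words (`Amalgam.lift_injective`) and by the Euclidean algorithm.
-/

/-! ### Central extensions and second homology -/

section CentralExtension

variable {A E G : Type*} [Group A] [Group E] [Group G]

/-- `IsCentralExtension i p` says that `1 → A → E → G → 1`, with maps `i` and `p`, is a central
extension of groups. -/
structure IsCentralExtension (i : A →* E) (p : E →* G) : Prop where
  injective : Function.Injective i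
  surjective : Function.Surjective p
  apply_eq_one_iff : ∀ x, p x = 1 ↔ ∃ a, i a = x
  commute : ∀ a x, Commute (i a) x

end CentralExtension

section Homology

open groupHomology Finsupp

variable {A G : Type} [AddCommGroup A] [Group G]

/-- A 2-cocycle `φ` with trivial coefficients induces a homomorphism on `H₂`. Its value on the
class of the torus cycle `(x, y) - (y, x)` of a commuting pair is `φ x y - φ y x`. -/
theorem exists_H2_hom_of_cocycle (φ : G → G → A)
    (hφ : ∀ g h k, φ g h + φ (g * h) k = φ h k + φ g (h * k)) :
    ∃ Φ : groupHomology (Rep.trivial ℤ G ℤ) 2 →+ A, ∀ x y : G, x * y = y * x →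
      ∃ c, Φ c = φ x y - φ y x := by
  let ev : (G × G →₀ ℤ) →ₗ[ℤ] A :=
    Finsupp.lsum ℤ fun g => LinearMap.toSpanSingleton ℤ A (φ g.1 g.2)
  have ev_single (g : G × G) (n : ℤ) : ev (single g n) = n • φ g.1 g.2 := by simp [ev]
  let d : (G × G × G →₀ ℤ) →ₗ[ℤ] (G × G →₀ ℤ) := (d₃₂ (Rep.trivial ℤ G ℤ)).hom
  have hd (g : G × G × G) (n : ℤ) : d (single g n) =
      single (g.2.1, g.2.2) n - single (g.1 * g.2.1, g.2.2) n +
      single (g.1, g.2.1 * g.2.2) n - single (g.1, g.2.1) n :=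
    d₃₂_single (A := Rep.trivial ℤ G ℤ) g n
  have ev_d : ev ∘ₗ d = 0 := by
    refine Finsupp.lhom_ext fun g n => ?_
    rw [LinearMap.comp_apply, hd]
    simp only [map_sub, map_add, ev_single, LinearMap.zero_apply]
    rw [← smul_sub, ← smul_add, ← smul_sub]
    have h := hφ g.1 g.2.1 g.2.2
    have h' : φ g.2.1 g.2.2 - φ (g.1 * g.2.1) g.2.2 + φ g.1 (g.2.1 * g.2.2) - φ g.1 g.2.1 = 0 := by
      rw [sub_add_eq_add_sub, ← h]
      abel
    rw [h', smul_zero]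
  let Z : Submodule ℤ (G × G →₀ ℤ) := cycles₂ (Rep.trivial ℤ G ℤ)
  let π : Z →ₗ[ℤ] groupHomology (Rep.trivial ℤ G ℤ) 2 := (H2π (Rep.trivial ℤ G ℤ)).hom
  have hπ : Function.Surjective π.toAddMonoidHom := fun x => by
    induction x using H2_induction_on with
    | h x => exact ⟨x, rfl⟩
  let ev' : Z →+ A := (ev ∘ₗ Z.subtype).toAddMonoidHom
  have hker : π.toAddMonoidHom.ker ≤ ev'.ker := by
    intro x hx
    obtain ⟨z, hz⟩ := (H2π_eq_zero_iff (A := Rep.trivial ℤ G ℤ) x).1 hx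
    have h1 : ev (d z) = 0 := LinearMap.congr_fun ev_d z
    have h2 : d z = x.1 := hz
    rw [h2] at h1
    exact h1
  refine ⟨π.toAddMonoidHom.liftOfSurjective hπ ⟨ev', hker⟩, fun x y hxy => ?_⟩
  have hc : (single (x, y) 1 - single (y, x) 1 : G × G →₀ ℤ) ∈ Z := by
    let d' : (G × G →₀ ℤ) →ₗ[ℤ] (G →₀ ℤ) := (d₂₁ (Rep.trivial ℤ G ℤ)).hom
    have hd' (g : G × G) (n : ℤ) : d' (single g n) =
        single g.2 n - single (g.1 * g.2) n + single g.1 n :=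
      d₂₁_single (A := Rep.trivial ℤ G ℤ) g n
    have : d' (single (x, y) 1 - single (y, x) 1) = 0 := by
      rw [map_sub, hd', hd', hxy]
      abel
    exact this
  refine ⟨π ⟨_, hc⟩, ?_⟩
  have := AddMonoidHom.liftOfRightInverse_comp_apply π.toAddMonoidHom _
    (Function.rightInverse_surjInv hπ) ⟨ev', hker⟩ ⟨_, hc⟩
  refine this.trans ?_
  change ev (single (x, y) 1 - single (y, x) 1) = _
  rw [map_sub, ev_single, ev_single, one_smul, one_smul]

variable {E Q : Type} [Group E] [Group Q]

/-- Let `E` be a central extension of `Q` by a group `A` of exponent two, and let `f : G → Q` be a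
homomorphism. If the images of `x` and of `y n` have lifts to `E` whose commutators `c n` are
pairwise distinct, while `x` commutes with every `y n` in `G`, then `H₂(G; ℤ)` is not finitely
generated: the pulled back extension class maps it onto a subgroup of `A` containing all `c n`. -/
theorem IsCentralExtension.not_fg_H2 {i : Multiplicative A →* E} {p : E →* Q}
    (h : IsCentralExtension i p) (hA : ∀ a : A, 2 • a = 0) (f : G →* Q)
    (x : G) (y : ℕ → G) (hxy : ∀ n, x * y n = y n * x) (u : E) (v : ℕ → E) (c : ℕ → A)
    (hu : p u = f x) (hv : ∀ n, p (v n) = f (y n))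
    (huv : ∀ n, u * v n = i (.ofAdd (c n)) * (v n * u)) (hc : Function.Injective c) :
    ¬ AddGroup.FG (groupHomology (Rep.trivial ℤ G ℤ) 2) := by
  intro hfg
  let s : G → E := fun g => Function.surjInv h.surjective (f g)
  have hs (g) : p (s g) = f g := Function.surjInv_eq h.surjective (f g)
  have hφ (g k : G) : ∃ a : A, s g * s k = i (.ofAdd a) * s (g * k) := by
    obtain ⟨a, ha⟩ := (h.apply_eq_one_iff (s g * s k * (s (g * k))⁻¹)).1 (by simp [hs])
    exact ⟨a.toAdd, by rw [ofAdd_toAdd, ha]; group⟩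
  -- `φ` is the pullback along `f` of the cocycle of the extension for the section `s`.
  choose φ hφ using hφ
  have inj {a b : A} {e : E} (hab : i (.ofAdd a) * e = i (.ofAdd b) * e) : a = b :=
    Multiplicative.ofAdd.injective (h.injective (mul_right_cancel hab))
  have cocycle (g k l : G) : φ g k + φ (g * k) l = φ k l + φ g (k * l) := by
    apply inj (e := s (g * k * l))
    rw [ofAdd_add, ofAdd_add, map_mul, map_mul]
    calc i (.ofAdd (φ g k)) * i (.ofAdd (φ (g * k) l)) * s (g * k * l)
        = s g * (s k * s l) := by rw [mul_assoc, ← hφ, ← mul_assoc, ← hφ, mul_assoc]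
      _ = i (.ofAdd (φ k l)) * (s g * s (k * l)) := by
        rw [hφ k l, ← mul_assoc, ← (h.commute _ _).eq, mul_assoc]
      _ = _ := by rw [hφ g, ← mul_assoc, mul_assoc g]
  obtain ⟨Φ, hΦ⟩ := exists_H2_hom_of_cocycle φ cocycle
  -- Commutators do not depend on the lifts, so `u` and `v n` may replace `s x` and `s (y n)`.
  have key (n : ℕ) : ∃ z, Φ z = c n := by
    obtain ⟨z, hz⟩ := hΦ x (y n) (hxy n)
    refine ⟨z, hz.trans ?_⟩
    obtain ⟨a, ha⟩ := (h.apply_eq_one_iff (s x * u⁻¹)).1 (by simp [hs, hu])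
    obtain ⟨b, hb⟩ := (h.apply_eq_one_iff (s (y n) * (v n)⁻¹)).1 (by simp [hs, hv])
    have hx : s x = i a * u := by rw [ha]; group
    have hy : s (y n) = i b * v n := by rw [hb]; group
    rw [sub_eq_iff_eq_add]
    apply inj (e := s (x * y n))
    rw [← hφ, ofAdd_add, map_mul, mul_assoc, hxy n, ← hφ, hx, hy]
    calc i a * u * (i b * v n) = i a * (u * i b) * v n := by group
      _ = i a * i b * (u * v n) := by rw [← (h.commute b u).eq]; group
      _ = i a * i b * i (.ofAdd (c n)) * (v n * u) := by rw [huv]; group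
      _ = i (.ofAdd (c n)) * (i b * (i a * v n) * u) := by
        rw [← (h.commute (.ofAdd (c n)) (i a * i b)).eq, (h.commute a (i b)).eq]; group
      _ = _ := by rw [(h.commute a (v n)).eq]; group
  have : AddGroup.FG Φ.range := AddGroup.fg_range Φ
  have htors : IsAddTorsion Φ.range := fun a =>
    isOfFinAddOrder_iff_nsmul_eq_zero.2 ⟨2, two_pos, Subtype.ext (hA a)⟩
  have : Finite Φ.range := AddCommGroup.finite_of_fg_isAddTorsion _ htors
  exact not_injective_infinite_finite (fun n => (⟨c n, key n⟩ : Φ.range))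
    fun m n hmn => hc (congrArg Subtype.val hmn)

end Homology

/-! ### Amalgamated products of two groups -/

section Amalgam

variable {H G₁ G₂ K : Type} [Group H] [Group G₁] [Group G₂] [Group K]

/-- The family of groups `G₁, G₂` indexed by `Bool`. -/
def BoolFamily (G₁ G₂ : Type) : Bool → Type
  | true => G₁
  | false => G₂

instance : ∀ b, Group (BoolFamily G₁ G₂ b)
  | true => inferInstanceAs (Group G₁)
  | false => inferInstanceAs (Group G₂)

/-- A pair of homomorphisms out of `H` as a family indexed by `Bool`. -/
def boolHom (φ₁ : H →* G₁) (φ₂ : H →* G₂) : ∀ b, H →* BoolFamily G₁ G₂ b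
  | true => φ₁
  | false => φ₂

/-- A pair of homomorphisms into `K` as a family indexed by `Bool`. -/
def boolDesc (j₁ : G₁ →* K) (j₂ : G₂ →* K) : ∀ b, BoolFamily G₁ G₂ b →* K
  | true => j₁
  | false => j₂

/-- The amalgamated free product of two groups. -/
def Amalgam (φ₁ : H →* G₁) (φ₂ : H →* G₂) : Type := Monoid.PushoutI (boolHom φ₁ φ₂)

instance (φ₁ : H →* G₁) (φ₂ : H →* G₂) : Group (Amalgam φ₁ φ₂) :=
  inferInstanceAs (Group (Monoid.PushoutI (boolHom φ₁ φ₂)))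

namespace Amalgam

variable {φ₁ : H →* G₁} {φ₂ : H →* G₂}

/-- The inclusion of the first factor. -/
def inl : G₁ →* Amalgam φ₁ φ₂ := Monoid.PushoutI.of (φ := boolHom φ₁ φ₂) true

/-- The inclusion of the second factor. -/
def inr : G₂ →* Amalgam φ₁ φ₂ := Monoid.PushoutI.of (φ := boolHom φ₁ φ₂) false

theorem inl_apply_eq_inr_apply (h : H) : (inl (φ₁ h) : Amalgam φ₁ φ₂) = inr (φ₂ h) :=
  (Monoid.PushoutI.of_apply_eq_base (boolHom φ₁ φ₂) true h).trans
    (Monoid.PushoutI.of_apply_eq_base (boolHom φ₁ φ₂) false h).symm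

theorem induction_on {motive : Amalgam φ₁ φ₂ → Prop} (x : Amalgam φ₁ φ₂)
    (inl : ∀ g, motive (inl g)) (inr : ∀ g, motive (inr g))
    (mul : ∀ x y, motive x → motive y → motive (x * y)) : motive x := by
  refine Monoid.PushoutI.induction_on x ?_ (fun h => ?_) mul
  · rintro (_ | _) g
    exacts [inr g, inl g]
  · rw [← Monoid.PushoutI.of_apply_eq_base (boolHom φ₁ φ₂) true h]
    exact inl _

/-- The homomorphism out of an amalgam given by its universal property. -/
def lift (j₁ : G₁ →* K) (j₂ : G₂ →* K) (h : j₁.comp φ₁ = j₂.comp φ₂) : Amalgam φ₁ φ₂ →* K :=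
  Monoid.PushoutI.lift (boolDesc j₁ j₂) (j₁.comp φ₁) (by
    rintro (_ | _)
    exacts [h.symm, rfl])

@[simp]
theorem lift_inl (j₁ : G₁ →* K) (j₂ : G₂ →* K) (h : j₁.comp φ₁ = j₂.comp φ₂) (g : G₁) :
    lift j₁ j₂ h (inl g) = j₁ g :=
  Monoid.PushoutI.lift_of (boolDesc j₁ j₂) _ _ (i := true) g

@[simp]
theorem lift_inr (j₁ : G₁ →* K) (j₂ : G₂ →* K) (h : j₁.comp φ₁ = j₂.comp φ₂) (g : G₂) :
    lift j₁ j₂ h (inr g) = j₂ g :=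
  Monoid.PushoutI.lift_of (boolDesc j₁ j₂) _ _ (i := false) g

theorem hom_ext {f g : Amalgam φ₁ φ₂ →* K} (h₁ : ∀ x, f (inl x) = g (inl x))
    (h₂ : ∀ x, f (inr x) = g (inr x)) : f = g := by
  refine MonoidHom.ext fun x => induction_on (motive := fun x => f x = g x) x
    h₁ h₂ fun x y hx hy => ?_
  rw [map_mul, map_mul, hx, hy]

theorem inl_injective (h₁ : Function.Injective φ₁) (h₂ : Function.Injective φ₂) :
    Function.Injective (inl : G₁ →* Amalgam φ₁ φ₂) :=
  Monoid.PushoutI.of_injective (φ := boolHom φ₁ φ₂) (by rintro (_ | _) <;> assumption) true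

/-- `Reduced b x` says that `x` is a nonempty alternating product of elements of the two factors
lying outside the amalgamated subgroup, with first letter in `G₁` if `b = true` and in `G₂`
otherwise. -/
inductive Reduced (φ₁ : H →* G₁) (φ₂ : H →* G₂) : Bool → Amalgam φ₁ φ₂ → Prop
  | inl (g : G₁) (hg : g ∉ φ₁.range) : Reduced φ₁ φ₂ true (inl g)
  | inr (g : G₂) (hg : g ∉ φ₂.range) : Reduced φ₁ φ₂ false (inr g)
  | inl_mul (g : G₁) (hg : g ∉ φ₁.range) (x : Amalgam φ₁ φ₂) (hx : Reduced φ₁ φ₂ false x) :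
      Reduced φ₁ φ₂ true (Amalgam.inl g * x)
  | inr_mul (g : G₂) (hg : g ∉ φ₂.range) (x : Amalgam φ₁ φ₂) (hx : Reduced φ₁ φ₂ true x) :
      Reduced φ₁ φ₂ false (Amalgam.inr g * x)

/-- Elements of an amalgam outside the amalgamated subgroup have a reduced form. -/
theorem exists_reduced (x : Amalgam φ₁ φ₂) :
    (∃ h, x = inl (φ₁ h)) ∨ ∃ b, Reduced φ₁ φ₂ b x := by
  let P : Amalgam φ₁ φ₂ → Prop := fun x => (∃ h, x = inl (φ₁ h)) ∨ ∃ b, Reduced φ₁ φ₂ b x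
  have hbase (h : H) (x) (hx : P x) : P (inl (φ₁ h) * x) := by
    have nl (g : G₁) (hg : g ∉ φ₁.range) : φ₁ h * g ∉ φ₁.range := fun h' =>
      hg ((Subgroup.mul_mem_cancel_left _ (MonoidHom.mem_range.2 ⟨h, rfl⟩)).1 h')
    have nr (g : G₂) (hg : g ∉ φ₂.range) : φ₂ h * g ∉ φ₂.range := fun h' =>
      hg ((Subgroup.mul_mem_cancel_left _ (MonoidHom.mem_range.2 ⟨h, rfl⟩)).1 h')
    rcases hx with ⟨k, rfl⟩ | ⟨b, hx⟩
    · exact .inl ⟨h * k, by simp⟩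
    · refine .inr ⟨b, ?_⟩
      cases hx with
      | inl g hg => rw [← map_mul]; exact .inl _ (nl g hg)
      | inr g hg => rw [inl_apply_eq_inr_apply, ← map_mul]; exact .inr _ (nr g hg)
      | inl_mul g hg x hx => rw [← mul_assoc, ← map_mul]; exact .inl_mul _ (nl g hg) x hx
      | inr_mul g hg x hx =>
        rw [← mul_assoc, inl_apply_eq_inr_apply, ← map_mul]; exact .inr_mul _ (nr g hg) x hx
  have hl (g : G₁) (x) (hx : P x) : P (inl g * x) := by
    by_cases hg : g ∈ φ₁.range
    · obtain ⟨h, rfl⟩ := hg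
      exact hbase h x hx
    rcases hx with ⟨k, rfl⟩ | ⟨b, hx⟩
    · rw [← map_mul]
      exact .inr ⟨true, .inl _ fun h' =>
        hg ((Subgroup.mul_mem_cancel_right _ (MonoidHom.mem_range.2 ⟨k, rfl⟩)).1 h')⟩
    cases hx with
    | inl g' hg' =>
      rw [← map_mul]
      by_cases h : g * g' ∈ φ₁.range
      · obtain ⟨k, hk⟩ := h
        exact .inl ⟨k, by rw [hk]⟩
      · exact .inr ⟨true, .inl _ h⟩
    | inr g' hg' => exact .inr ⟨true, .inl_mul g hg _ (.inr g' hg')⟩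
    | inl_mul g' hg' x hx =>
      rw [← mul_assoc, ← map_mul]
      by_cases h : g * g' ∈ φ₁.range
      · obtain ⟨k, hk⟩ := h
        rw [← hk]
        exact hbase k x (.inr ⟨_, hx⟩)
      · exact .inr ⟨true, .inl_mul _ h x hx⟩
    | inr_mul g' hg' x hx => exact .inr ⟨true, .inl_mul g hg _ (.inr_mul g' hg' x hx)⟩
  have hr (g : G₂) (x) (hx : P x) : P (inr g * x) := by
    by_cases hg : g ∈ φ₂.range
    · obtain ⟨h, rfl⟩ := hg
      rw [← inl_apply_eq_inr_apply]
      exact hbase h x hx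
    rcases hx with ⟨k, rfl⟩ | ⟨b, hx⟩
    · rw [inl_apply_eq_inr_apply, ← map_mul]
      exact .inr ⟨false, .inr _ fun h' =>
        hg ((Subgroup.mul_mem_cancel_right _ (MonoidHom.mem_range.2 ⟨k, rfl⟩)).1 h')⟩
    cases hx with
    | inl g' hg' => exact .inr ⟨false, .inr_mul g hg _ (.inl g' hg')⟩
    | inr g' hg' =>
      rw [← map_mul]
      by_cases h : g * g' ∈ φ₂.range
      · obtain ⟨k, hk⟩ := h
        exact .inl ⟨k, by rw [inl_apply_eq_inr_apply, hk]⟩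
      · exact .inr ⟨false, .inr _ h⟩
    | inl_mul g' hg' x hx => exact .inr ⟨false, .inr_mul g hg _ (.inl_mul g' hg' x hx)⟩
    | inr_mul g' hg' x hx =>
      rw [← mul_assoc, ← map_mul]
      by_cases h : g * g' ∈ φ₂.range
      · obtain ⟨k, hk⟩ := h
        rw [← hk, ← inl_apply_eq_inr_apply]
        exact hbase k x (.inr ⟨_, hx⟩)
      · exact .inr ⟨false, .inr_mul _ h x hx⟩
  have key (x : Amalgam φ₁ φ₂) : ∀ y, P y → P (x * y) := by
    refine induction_on (motive := fun x => ∀ y, P y → P (x * y)) x hl hr fun x x' hx hx' y hy => ?_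
    rw [mul_assoc]
    exact hx _ (hx' _ hy)
  have := key x 1 (.inl ⟨1, by simp⟩)
  rwa [mul_one] at this

/-- A ping-pong criterion for a homomorphism out of an amalgam to be injective: reduced elements
starting in `Gᵢ` are mapped into the set `Sᵢ`, which does not contain `1`. -/
theorem lift_injective {j₁ : G₁ →* K} {j₂ : G₂ →* K} (h : j₁.comp φ₁ = j₂.comp φ₂)
    (hφ : Function.Injective (j₁.comp φ₁)) (S₁ S₂ : Set K)
    (h₁ : ∀ g ∉ φ₁.range, j₁ g ∈ S₁) (h₂ : ∀ g ∉ φ₂.range, j₂ g ∈ S₂)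
    (h₁₂ : ∀ g ∉ φ₁.range, ∀ x ∈ S₂, j₁ g * x ∈ S₁)
    (h₂₁ : ∀ g ∉ φ₂.range, ∀ x ∈ S₁, j₂ g * x ∈ S₂)
    (hS₁ : 1 ∉ S₁) (hS₂ : 1 ∉ S₂) : Function.Injective (lift j₁ j₂ h) := by
  rw [injective_iff_map_eq_one]
  intro x hx
  rcases exists_reduced x with ⟨k, rfl⟩ | ⟨b, hb⟩
  · rw [lift_inl] at hx
    rw [hφ (hx.trans (map_one (j₁.comp φ₁)).symm), map_one, map_one]
  · have : lift j₁ j₂ h x ∈ (bif b then S₁ else S₂) := by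
      clear hx
      induction hb with
      | inl g hg => simpa using h₁ g hg
      | inr g hg => simpa using h₂ g hg
      | inl_mul g hg x _ ih => rw [map_mul, lift_inl]; exact h₁₂ g hg _ ih
      | inr_mul g hg x _ ih => rw [map_mul, lift_inr]; exact h₂₁ g hg _ ih
    rw [hx] at this
    cases b
    exacts [(hS₂ this).elim, (hS₁ this).elim]

end Amalgam

section

variable {A E₀ E₁ E₂ H G₁ G₂ K : Type} [Group A] [Group E₀] [Group E₁] [Group E₂]
  [Group H] [Group G₁] [Group G₂] [Group K]

theorem IsCentralExtension.injective_of_comm {i₀ : A →* E₀} {p₀ : E₀ →* H} {i₁ : A →* E₁}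
    {p₁ : E₁ →* G₁} (e₀ : IsCentralExtension i₀ p₀) (e₁ : IsCentralExtension i₁ p₁)
    {φ : H →* G₁} {ψ : E₀ →* E₁} (hφ : Function.Injective φ) (hi : ψ.comp i₀ = i₁)
    (hp : p₁.comp ψ = φ.comp p₀) : Function.Injective ψ := by
  rw [injective_iff_map_eq_one]
  intro x hx
  have h1 : φ (p₀ x) = 1 := by
    rw [← MonoidHom.comp_apply, ← hp, MonoidHom.comp_apply, hx, map_one]
  obtain ⟨a, rfl⟩ := (e₀.apply_eq_one_iff x).1 (hφ (h1.trans (map_one φ).symm))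
  rw [← MonoidHom.comp_apply, hi] at hx
  rw [e₁.injective (hx.trans (map_one i₁).symm), map_one]

/-- Compatible central extensions by `A` of the groups in an amalgam decomposition of `K` glue to a
central extension of `K`: the amalgam of the extensions contains `A` because the factors embed in an
amalgam, and modulo `A` it has the universal property of the amalgam `K`. -/
theorem IsCentralExtension.amalgam {i₀ : A →* E₀} {p₀ : E₀ →* H} {i₁ : A →* E₁} {p₁ : E₁ →* G₁}
    {i₂ : A →* E₂} {p₂ : E₂ →* G₂} (e₀ : IsCentralExtension i₀ p₀)
    (e₁ : IsCentralExtension i₁ p₁) (e₂ : IsCentralExtension i₂ p₂)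
    {φ₁ : H →* G₁} {φ₂ : H →* G₂} {ψ₁ : E₀ →* E₁} {ψ₂ : E₀ →* E₂}
    (hφ₁ : Function.Injective φ₁) (hφ₂ : Function.Injective φ₂)
    (hi₁ : ψ₁.comp i₀ = i₁) (hi₂ : ψ₂.comp i₀ = i₂)
    (hp₁ : p₁.comp ψ₁ = φ₁.comp p₀) (hp₂ : p₂.comp ψ₂ = φ₂.comp p₀)
    {j₁ : G₁ →* K} {j₂ : G₂ →* K} (hj : j₁.comp φ₁ = j₂.comp φ₂)
    (hinj : Function.Injective (Amalgam.lift j₁ j₂ hj)) (hsurj : j₁.range ⊔ j₂.range = ⊤)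
    {p : Amalgam ψ₁ ψ₂ →* K} (hpl : ∀ x, p (Amalgam.inl x) = j₁ (p₁ x))
    (hpr : ∀ x, p (Amalgam.inr x) = j₂ (p₂ x)) :
    IsCentralExtension ((Amalgam.inl (φ₁ := ψ₁) (φ₂ := ψ₂)).comp i₁) p := by
  have hψ₁ := e₀.injective_of_comm e₁ hφ₁ hi₁ hp₁
  have hψ₂ := e₀.injective_of_comm e₂ hφ₂ hi₂ hp₂
  have hlr (a : A) : (Amalgam.inl (i₁ a) : Amalgam ψ₁ ψ₂) = Amalgam.inr (i₂ a) := by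
    rw [← hi₁, ← hi₂]
    exact Amalgam.inl_apply_eq_inr_apply _
  have hcomm (a : A) (x : Amalgam ψ₁ ψ₂) : Commute (Amalgam.inl (i₁ a)) x := by
    refine Amalgam.induction_on x (fun g => ?_) (fun g => ?_) fun x y hx hy => hx.mul_right hy
    · exact (e₁.commute a g).map Amalgam.inl
    · rw [hlr]
      exact (e₂.commute a g).map Amalgam.inr
  refine ⟨(Amalgam.inl_injective hψ₁ hψ₂).comp e₁.injective, ?_, fun x => ⟨fun hx => ?_, ?_⟩, hcomm⟩
  · rw [← MonoidHom.range_eq_top, eq_top_iff, ← hsurj, sup_le_iff]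
    constructor
    · rintro _ ⟨g, rfl⟩
      obtain ⟨x, rfl⟩ := e₁.surjective g
      exact ⟨_, hpl x⟩
    · rintro _ ⟨g, rfl⟩
      obtain ⟨x, rfl⟩ := e₂.surjective g
      exact ⟨_, hpr x⟩
  · -- The quotient map by the image `N` of `A` factors through the amalgam of the `Gᵢ`, that is,
    -- through `K`, so the kernel of `p` is contained in `N`.
    let N : Subgroup (Amalgam ψ₁ ψ₂) := ((Amalgam.inl (φ₁ := ψ₁) (φ₂ := ψ₂)).comp i₁).range
    have hN : N.Normal := ⟨by
      rintro _ ⟨a, rfl⟩ g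
      refine ⟨a, ?_⟩
      have := (hcomm a g).eq
      rw [MonoidHom.comp_apply, ← this, mul_inv_cancel_right]⟩
    let f₁ : G₁ →* Amalgam ψ₁ ψ₂ ⧸ N := p₁.liftOfSurjective e₁.surjective
      ⟨(QuotientGroup.mk' N).comp Amalgam.inl, fun x hx => by
        obtain ⟨a, rfl⟩ := (e₁.apply_eq_one_iff x).1 hx
        exact (QuotientGroup.eq_one_iff _).2 ⟨a, rfl⟩⟩
    let f₂ : G₂ →* Amalgam ψ₁ ψ₂ ⧸ N := p₂.liftOfSurjective e₂.surjective
      ⟨(QuotientGroup.mk' N).comp Amalgam.inr, fun x hx => by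
        obtain ⟨a, rfl⟩ := (e₂.apply_eq_one_iff x).1 hx
        exact (QuotientGroup.eq_one_iff _).2 ⟨a, hlr a⟩⟩
    have hf₁ (x : E₁) : f₁ (p₁ x) = QuotientGroup.mk' N (Amalgam.inl x) :=
      MonoidHom.liftOfRightInverse_comp_apply p₁ _ (Function.rightInverse_surjInv e₁.surjective) _ x
    have hf₂ (x : E₂) : f₂ (p₂ x) = QuotientGroup.mk' N (Amalgam.inr x) :=
      MonoidHom.liftOfRightInverse_comp_apply p₂ _ (Function.rightInverse_surjInv e₂.surjective) _ x
    let q : Amalgam φ₁ φ₂ →* Amalgam ψ₁ ψ₂ ⧸ N := Amalgam.lift f₁ f₂ (by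
      ext y
      obtain ⟨x, rfl⟩ := e₀.surjective y
      have a1 := DFunLike.congr_fun hp₁ x
      have a2 := DFunLike.congr_fun hp₂ x
      simp only [MonoidHom.comp_apply] at a1 a2 ⊢
      rw [← a1, ← a2, hf₁, hf₂, Amalgam.inl_apply_eq_inr_apply])
    let r : Amalgam ψ₁ ψ₂ →* Amalgam φ₁ φ₂ :=
      Amalgam.lift (Amalgam.inl.comp p₁) (Amalgam.inr.comp p₂) (by
        ext x
        have a1 := DFunLike.congr_fun hp₁ x
        have a2 := DFunLike.congr_fun hp₂ x
        simp only [MonoidHom.comp_apply] at a1 a2 ⊢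
        rw [a1, a2, Amalgam.inl_apply_eq_inr_apply])
    have hqr : q.comp r = QuotientGroup.mk' N :=
      Amalgam.hom_ext (fun x => by simp [q, r, hf₁]) (fun x => by simp [q, r, hf₂])
    have hpr' : (Amalgam.lift j₁ j₂ hj).comp r = p :=
      Amalgam.hom_ext (fun x => by simp [r, hpl]) (fun x => by simp [r, hpr])
    have hrx : r x = 1 := hinj (by
      rw [map_one, ← hx, ← hpr']
      rfl)
    have : QuotientGroup.mk' N x = 1 := by
      rw [← hqr, MonoidHom.comp_apply, hrx, map_one]
    exact (QuotientGroup.eq_one_iff x).1 this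
  · rintro ⟨a, rfl⟩
    rw [MonoidHom.comp_apply, hpl, (e₁.apply_eq_one_iff _).2 ⟨a, rfl⟩, map_one]

end

end Amalgam

/-! ### A Heisenberg group over the polynomial ring -/

section Heisenberg

open Polynomial

variable {F : Type} [CommRing F]

/-- The pairing `(f, g) ↦ (∑ᵢ fᵢ gᵢ₊ₙ₊₁)ₙ` of polynomials: the coefficients of positive degree of
the Laurent polynomial `f(t⁻¹) g(t)`. -/
noncomputable def shiftPairing (f g : F[X]) : ℕ → F :=
  fun n => f.sum fun i a => a * g.coeff (i + n + 1)

theorem shiftPairing_add_left (f f' g : F[X]) :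
    shiftPairing (f + f') g = shiftPairing f g + shiftPairing f' g := by
  ext n
  exact sum_add_index f f' _ (by simp) (by intros; ring)

theorem shiftPairing_add_right (f g g' : F[X]) :
    shiftPairing f (g + g') = shiftPairing f g + shiftPairing f g' := by
  ext n
  simp only [shiftPairing, coeff_add, mul_add, Pi.add_apply, Polynomial.sum_add]

theorem shiftPairing_monomial (i : ℕ) (a : F) (g : F[X]) (n : ℕ) :
    shiftPairing (monomial i a) g n = a * g.coeff (i + n + 1) :=
  sum_monomial_index a _ (by simp)

@[simp]
theorem shiftPairing_zero_left (g : F[X]) : shiftPairing 0 g = 0 := by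
  ext n
  simp [shiftPairing]

@[simp]
theorem shiftPairing_zero_right (f : F[X]) : shiftPairing f 0 = 0 := by
  ext n
  simp [shiftPairing, Polynomial.sum]

/-- Shift invariance of the pairing. It makes the Heisenberg extension compatible with the
conjugations of `SL₂` that multiply the entry of a unitriangular matrix by `t`. -/
theorem shiftPairing_X_mul (f g : F[X]) : shiftPairing (X * f) (X * g) = shiftPairing f g := by
  induction f using Polynomial.induction_on' with
  | add p q hp hq => rw [mul_add, shiftPairing_add_left, shiftPairing_add_left, hp, hq]
  | monomial i a =>
    ext n
    rw [X_mul_monomial, shiftPairing_monomial, shiftPairing_monomial,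
      show i + 1 + n + 1 = i + n + 1 + 1 by ring, coeff_X_mul]

/-- Constants pair trivially because only positive degrees are kept, so that the Heisenberg
extension splits over them. -/
theorem shiftPairing_C_right (f : F[X]) (b : F) : shiftPairing f (C b) = 0 := by
  ext n
  simp [shiftPairing, Polynomial.sum]

theorem shiftPairing_one_X_pow (m : ℕ) :
    shiftPairing (1 : F[X]) (X ^ (m + 1)) = Pi.single m 1 := by
  ext n
  rw [← monomial_zero_one, shiftPairing_monomial]
  simp [coeff_X_pow, Pi.single_apply]

theorem shiftPairing_one_right (f : F[X]) : shiftPairing f 1 = 0 := by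
  simpa using shiftPairing_C_right f 1

variable (F) in
/-- The Heisenberg-type group on `F[X] × (ℕ → F)` whose multiplication is twisted by
`shiftPairing`. -/
@[ext]
structure Heis where
  /-- The polynomial coordinate. -/
  poly : F[X]
  /-- The central coordinate. -/
  cen : ℕ → F

namespace Heis

noncomputable instance : Group (Heis F) :=
  letI : Mul (Heis F) := ⟨fun x y => ⟨x.poly + y.poly, x.cen + y.cen + shiftPairing x.poly y.poly⟩⟩
  letI : One (Heis F) := ⟨⟨0, 0⟩⟩
  letI : Inv (Heis F) := ⟨fun x => ⟨-x.poly, -x.cen + shiftPairing x.poly x.poly⟩⟩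
  Group.ofLeftAxioms
    (fun x y z => by
      refine Heis.ext (add_assoc _ _ _) ?_
      change x.cen + y.cen + shiftPairing x.poly y.poly + z.cen + shiftPairing (_ + _) _ =
        x.cen + (y.cen + z.cen + shiftPairing y.poly z.poly) + shiftPairing _ (_ + _)
      rw [shiftPairing_add_left, shiftPairing_add_right]
      abel)
    (fun x => by
      refine Heis.ext (zero_add _) ?_
      change 0 + x.cen + shiftPairing 0 x.poly = x.cen
      simp)
    (fun x => by
      refine Heis.ext (neg_add_cancel _) ?_
      change -x.cen + shiftPairing x.poly x.poly + x.cen + shiftPairing (-x.poly) x.poly = 0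
      have : shiftPairing (-x.poly) x.poly + shiftPairing x.poly x.poly = 0 := by
        rw [← shiftPairing_add_left, neg_add_cancel, shiftPairing_zero_left]
      rw [← this]
      abel)

@[simp] theorem poly_mul (x y : Heis F) : (x * y).poly = x.poly + y.poly := rfl

@[simp] theorem cen_mul (x y : Heis F) :
    (x * y).cen = x.cen + y.cen + shiftPairing x.poly y.poly := rfl

@[simp] theorem poly_one : (1 : Heis F).poly = 0 := rfl

@[simp] theorem cen_one : (1 : Heis F).cen = 0 := rfl

/-- The inclusion of the central coordinate. -/
noncomputable def inl : Multiplicative (ℕ → F) →* Heis F where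
  toFun a := ⟨0, a.toAdd⟩
  map_one' := rfl
  map_mul' a b := by ext <;> simp

/-- The projection to the polynomial coordinate. -/
noncomputable def proj : Heis F →* Multiplicative F[X] where
  toFun x := .ofAdd x.poly
  map_one' := rfl
  map_mul' _ _ := rfl

/-- The endomorphism `f ↦ X f` of the Heisenberg group, which is the identity on the centre. -/
noncomputable def shift : Heis F →* Heis F where
  toFun x := ⟨X * x.poly, x.cen⟩
  map_one' := by ext <;> simp
  map_mul' x y := by
    refine Heis.ext (mul_add _ _ _) ?_
    simp [shiftPairing_X_mul]

/-- The splitting over the constant polynomials, combined with the centre. -/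
noncomputable def ofConst : Multiplicative (ℕ → F) × Multiplicative F →* Heis F where
  toFun x := ⟨C x.2.toAdd, x.1.toAdd⟩
  map_one' := by ext <;> simp
  map_mul' x y := by
    ext1
    · simp
    · simp [shiftPairing_C_right]

@[simp] theorem poly_inl (a : Multiplicative (ℕ → F)) : (inl a).poly = 0 := rfl
@[simp] theorem cen_inl (a : Multiplicative (ℕ → F)) : (inl a).cen = a.toAdd := rfl
@[simp] theorem proj_apply (x : Heis F) : proj x = .ofAdd x.poly := rfl
@[simp] theorem poly_shift (x : Heis F) : (shift x).poly = X * x.poly := rfl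
@[simp] theorem cen_shift (x : Heis F) : (shift x).cen = x.cen := rfl

theorem isCentralExtension : IsCentralExtension (inl : _ →* Heis F) proj where
  injective a b h := congrArg Heis.cen h
  surjective f := ⟨⟨f.toAdd, 0⟩, rfl⟩
  apply_eq_one_iff x := by
    constructor
    · intro h
      exact ⟨.ofAdd x.cen, Heis.ext (Multiplicative.ofAdd.injective h).symm rfl⟩
    · rintro ⟨a, rfl⟩
      rfl
  commute a x := by
    ext1 <;> simp [add_comm]

/-- The commutator of the lifts of `1` and `X ^ (m + 1)` is the `m`-th unit vector. -/
theorem one_mul_X_pow (m : ℕ) :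
    (⟨1, 0⟩ * ⟨X ^ (m + 1), 0⟩ : Heis F) =
      inl (.ofAdd (Pi.single m 1)) * (⟨X ^ (m + 1), 0⟩ * ⟨1, 0⟩) := by
  ext1
  · simp [add_comm]
  · simp [shiftPairing_one_X_pow, shiftPairing_one_right]

end Heis

end Heisenberg

/-! ### Elementary matrices and the Euclidean algorithm -/

section SL2

open Polynomial Matrix

/-- The group `SL₂(R)`. -/
abbrev SL2 (R : Type) [CommRing R] : Type := Matrix.SpecialLinearGroup (Fin 2) R

namespace SL2

section General

variable {R : Type} [CommRing R]

theorem mul_entry (M N : SL2 R) (i j : Fin 2) :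
    (M * N) i j = M i 0 * N 0 j + M i 1 * N 1 j := by
  change (M.1 * N.1) i j = _
  rw [Matrix.mul_apply, Fin.sum_univ_two]

theorem det_eq (M : SL2 R) : M 0 0 * M 1 1 - M 0 1 * M 1 0 = 1 := by
  rw [← Matrix.det_fin_two, M.det_coe]

theorem ext' {M N : SL2 R} (h₀₀ : M 0 0 = N 0 0) (h₀₁ : M 0 1 = N 0 1) (h₁₀ : M 1 0 = N 1 0)
    (h₁₁ : M 1 1 = N 1 1) : M = N := by
  ext i j
  fin_cases i <;> fin_cases j <;> assumption

/-- The matrix `!![a, b; c, d]`. -/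
def mk (a b c d : R) (h : a * d - b * c = 1) : SL2 R :=
  ⟨!![a, b; c, d], by rw [Matrix.det_fin_two_of, h]⟩

section mk

variable (a b c d : R) (h : a * d - b * c = 1)

@[simp] theorem mk_zero_zero : mk a b c d h 0 0 = a := rfl
@[simp] theorem mk_zero_one : mk a b c d h 0 1 = b := rfl
@[simp] theorem mk_one_zero : mk a b c d h 1 0 = c := rfl
@[simp] theorem mk_one_one : mk a b c d h 1 1 = d := rfl

end mk

@[simp] theorem one_one_zero : (1 : SL2 R) 1 0 = 0 := rfl

/-- The upper unitriangular matrices. -/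
def upper : Multiplicative R →* SL2 R where
  toFun x := mk 1 x.toAdd 0 1 (by ring)
  map_one' := ext' rfl rfl rfl rfl
  map_mul' x y := by apply ext' <;> simp [mul_entry, add_comm]

/-- The lower unitriangular matrices. -/
def lower : Multiplicative R →* SL2 R where
  toFun x := mk 1 0 x.toAdd 1 (by ring)
  map_one' := ext' rfl rfl rfl rfl
  map_mul' x y := by apply ext' <;> simp [mul_entry]

section

variable (x : Multiplicative R)

@[simp] theorem upper_zero_zero : upper x 0 0 = 1 := rfl
@[simp] theorem upper_zero_one : upper x 0 1 = x.toAdd := rfl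
@[simp] theorem upper_one_zero : upper x 1 0 = 0 := rfl
@[simp] theorem upper_one_one : upper x 1 1 = 1 := rfl
@[simp] theorem lower_zero_zero : lower x 0 0 = 1 := rfl
@[simp] theorem lower_zero_one : lower x 0 1 = 0 := rfl
@[simp] theorem lower_one_zero : lower x 1 0 = x.toAdd := rfl
@[simp] theorem lower_one_one : lower x 1 1 = 1 := rfl

end

variable (R) in
/-- The Weyl element `!![0, 1; -1, 0]`. -/
def weyl : SL2 R := mk 0 1 (-1) 0 (by ring)

@[simp] theorem weyl_zero_zero : weyl R 0 0 = 0 := rfl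
@[simp] theorem weyl_zero_one : weyl R 0 1 = 1 := rfl
@[simp] theorem weyl_one_zero : weyl R 1 0 = -1 := rfl
@[simp] theorem weyl_one_one : weyl R 1 1 = 0 := rfl

theorem weyl_mul_upper (x : R) :
    weyl R * upper (.ofAdd x) = lower (.ofAdd (-x)) * weyl R := by
  apply ext' <;> simp [mul_entry, -ofAdd_neg]

@[simp]
theorem map_entry {S : Type} [CommRing S] (f : R →+* S) (M : SL2 R) (i j : Fin 2) :
    SpecialLinearGroup.map f M i j = f (M i j) := rfl

theorem map_upper {S : Type} [CommRing S] (f : R →+* S) (x : R) :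
    SpecialLinearGroup.map f (upper (.ofAdd x)) = upper (.ofAdd (f x)) := by
  apply ext' <;> simp

theorem map_weyl {S : Type} [CommRing S] (f : R →+* S) :
    SpecialLinearGroup.map f (weyl R) = weyl S := by
  apply ext' <;> simp

/-- The Euclidean algorithm: if the first column of `M` is proportional to a column of
polynomials, then it can be cleared by row operations with polynomial coefficients. -/
theorem exists_mul_one_zero_eq_zero {F : Type} [Field F] (hneg : ∀ x : R, -x = x)
    (φ : F[X] →+* R) (K : Subgroup (SL2 R)) (hu : ∀ q, upper (.ofAdd (φ q)) ∈ K)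
    (hw : weyl R ∈ K) (u : R) (c a : F[X]) :
    ∀ M : SL2 R, M 0 0 = u * φ a → M 1 0 = u * φ c → ∃ k ∈ K, (k * M) 1 0 = 0 := by
  induction c, a using EuclideanDomain.GCD.induction with
  | H0 a => exact fun M _ h => ⟨1, K.one_mem, by rw [one_mul, h, map_zero, mul_zero]⟩
  | H1 c a _ ih =>
    intro M hM₀ hM₁
    have hmod : u * φ (a % c) = u * φ a + φ (a / c) * (u * φ c) := by
      rw [EuclideanDomain.mod_eq_sub_mul_div, map_sub, sub_eq_add_neg, hneg, map_mul]
      ring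
    obtain ⟨k, hk, hkM⟩ := ih (weyl R * upper (.ofAdd (φ (a / c))) * M)
      (by simp [mul_entry, hM₁])
      (by rw [hmod]; simp [mul_entry, hM₀, hM₁, hneg])
    exact ⟨k * (weyl R * upper (.ofAdd (φ (a / c)))), K.mul_mem hk (K.mul_mem hw (hu _)),
      by rwa [mul_assoc]⟩

end General

local notation "𝔽" => ZMod 2

/-! ### The decomposition of `SL₂(𝔽₂[X])` -/

section PolynomialRing

/-- Rings receiving a homomorphism from `𝔽₂` have characteristic two. -/
theorem neg_eq_self {R : Type} [CommRing R] (f : 𝔽 →+* R) (x : R) : -x = x := by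
  have h : (2 : R) = 0 := by
    rw [← map_ofNat f 2, show (OfNat.ofNat 2 : 𝔽) = 0 from rfl, map_zero]
  rw [neg_eq_iff_add_eq_zero, ← two_mul, h, zero_mul]

theorem eq_one_of_mul_eq_one {a d : 𝔽[X]} (h : a * d = 1) : a = 1 := by
  obtain ⟨r, hr, rfl⟩ := Polynomial.isUnit_iff.1 (IsUnit.of_mul_eq_one d h)
  have : ∀ r : 𝔽, r ≠ 0 → r = 1 := by decide
  rw [this r hr.ne_zero, map_one]

/-- Elements of `SL₂(𝔽₂)` that are not upper triangular. -/
theorem one_zero_ne_zero {g : SL2 𝔽} (hg : g ∉ (upper (R := 𝔽)).range) : g 1 0 ≠ 0 := by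
  intro h
  have hd := det_eq g
  rw [h, mul_zero, sub_zero] at hd
  have : ∀ a d : 𝔽, a * d = 1 → a = 1 ∧ d = 1 := by decide
  obtain ⟨ha, hd⟩ := this _ _ hd
  exact hg ⟨.ofAdd (g 0 1), ext' ha.symm rfl h.symm hd.symm⟩

/-- `SL₂(𝔽₂[X])` is generated by the constant and the upper unitriangular matrices. -/
theorem constants_sup_upper :
    (SpecialLinearGroup.map (n := Fin 2) (C : 𝔽 →+* 𝔽[X])).range ⊔ (upper (R := 𝔽[X])).range =
      ⊤ := by
  rw [eq_top_iff]
  intro M _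
  set K := (SpecialLinearGroup.map (n := Fin 2) (C : 𝔽 →+* 𝔽[X])).range ⊔
    (upper (R := 𝔽[X])).range
  have hu (q : 𝔽[X]) : upper (.ofAdd q) ∈ K := Subgroup.mem_sup_right ⟨_, rfl⟩
  have hw : weyl 𝔽[X] ∈ K :=
    Subgroup.mem_sup_left ⟨weyl 𝔽, map_weyl C⟩
  obtain ⟨k, hk, hkM⟩ := exists_mul_one_zero_eq_zero (neg_eq_self C) (RingHom.id _) K hu hw 1
    (M 1 0) (M 0 0) M (by simp) (by simp)
  rw [← K.mul_mem_cancel_left hk]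
  have hd := det_eq (k * M)
  rw [hkM, mul_zero, sub_zero] at hd
  have : k * M = upper (.ofAdd ((k * M) 0 1)) :=
    ext' (eq_one_of_mul_eq_one hd) rfl hkM
      (eq_one_of_mul_eq_one (d := (k * M) 0 0) (by rw [mul_comm]; exact hd))
  rw [this]
  exact hu _

theorem constants_comp_upper :
    (SpecialLinearGroup.map (n := Fin 2) (C : 𝔽 →+* 𝔽[X])).comp upper =
      upper.comp (AddMonoidHom.toMultiplicative (C : 𝔽 →+* 𝔽[X]).toAddMonoidHom) := by
  exact MonoidHom.ext fun x => map_upper C x.toAdd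

theorem constants_injective :
    Function.Injective (AddMonoidHom.toMultiplicative (C : 𝔽 →+* 𝔽[X]).toAddMonoidHom) :=
  fun _ _ h => Multiplicative.toAdd.injective (C_injective (congrArg Multiplicative.toAdd h))

theorem degree_C_mul_le (r : 𝔽) (p : 𝔽[X]) : (C r * p).degree ≤ p.degree := by
  rw [← smul_eq_C_mul]
  exact degree_smul_le r p

theorem upper_injective {R : Type} [CommRing R] : Function.Injective (upper (R := R)) :=
  fun _ _ h => congrArg (fun M : SL2 R => M 0 1) h

/-- `SL₂(𝔽₂[X])` is the amalgam of `SL₂(𝔽₂)` and the upper unitriangular group over their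
intersection. The ping-pong compares the degrees of the two entries of the first column. -/
theorem constants_upper_lift_injective :
    Function.Injective (Amalgam.lift (SpecialLinearGroup.map (n := Fin 2) (C : 𝔽 →+* 𝔽[X])) upper
      constants_comp_upper) := by
  have deg_u {u : Multiplicative 𝔽[X]}
      (hu : u ∉ (AddMonoidHom.toMultiplicative (C : 𝔽 →+* 𝔽[X]).toAddMonoidHom).range) :
      0 < u.toAdd.degree := by
    by_contra! h
    exact hu ⟨.ofAdd (u.toAdd.coeff 0),
      Multiplicative.toAdd.injective (eq_C_of_degree_le_zero h).symm⟩
  refine Amalgam.lift_injective _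
    (by rw [constants_comp_upper]; exact upper_injective.comp constants_injective)
    {M | M 1 0 ≠ 0 ∧ (M 0 0).degree ≤ (M 1 0).degree} {M | (M 1 0).degree < (M 0 0).degree ∧ M ≠ 1}
    ?_ ?_ ?_ ?_ ?_ ?_
  · intro g hg
    have h := one_zero_ne_zero hg
    refine ⟨by simpa using h, ?_⟩
    rw [map_entry, map_entry, degree_C h]
    exact degree_C_le
  · intro u hu
    have h := deg_u hu
    refine ⟨by simp, fun h1 => ?_⟩
    have : u.toAdd = 0 := congrArg (fun M : SL2 𝔽[X] => M 0 1) h1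
    simp [this] at h
  · rintro g hg M ⟨hM, -⟩
    have h := one_zero_ne_zero hg
    have h0 : M 0 0 ≠ 0 := by
      intro h0
      simp [h0] at hM
    have e1 : ((SpecialLinearGroup.map C g * M) 1 0).degree = (M 0 0).degree := by
      rw [mul_entry, map_entry, map_entry, degree_add_eq_left_of_degree_lt, degree_C_mul h]
      rw [degree_C_mul h]
      refine lt_of_le_of_lt ?_ hM
      exact (degree_C_mul_le _ _)
    refine ⟨fun h' => ?_, ?_⟩
    · rw [h', degree_zero, eq_comm, degree_eq_bot] at e1
      exact h0 e1
    · rw [e1, mul_entry, map_entry, map_entry]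
      refine (degree_add_le _ _).trans (max_le (degree_C_mul_le _ _) ?_)
      exact (degree_C_mul_le _ _).trans hM.le
  · rintro u hu M ⟨hM, hM'⟩
    have h := deg_u hu
    have hc : (upper u * M) 1 0 = M 1 0 := by simp [mul_entry]
    have hlt : (M 1 0).degree < (u.toAdd * M 1 0).degree := by
      rw [degree_mul]
      have h1 := degree_eq_natDegree hM
      have h2 := degree_eq_natDegree (ne_zero_of_degree_gt h)
      rw [h2] at h
      rw [h1, h2]
      norm_cast at h ⊢
      omega
    refine ⟨?_, fun h' => hM ?_⟩
    · rw [hc, mul_entry, upper_zero_zero, one_mul, upper_zero_one,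
        degree_add_eq_right_of_degree_lt (hM'.trans_lt hlt)]
      exact hlt
    · rw [← hc, h', one_one_zero]
  · exact fun h => h.1 rfl
  · exact fun h => h.2 rfl

end PolynomialRing

/-! ### The decomposition of the congruence subgroup -/

section Congruence

/-- The subgroup of `SL₂(𝔽₂[X])` of matrices that are upper triangular modulo `X`. -/
def Gamma : Subgroup (SL2 𝔽[X]) where
  carrier := {M | (M 1 0).coeff 0 = 0}
  one_mem' := by simp
  mul_mem' {M N} hM hN := by
    rw [Set.mem_ofPred_eq] at hM hN ⊢
    rw [mul_entry, coeff_add, mul_coeff_zero, mul_coeff_zero, hM, hN, zero_mul, mul_zero, add_zero]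
  inv_mem' {M} hM := by
    rw [Set.mem_ofPred_eq] at hM ⊢
    change (M.1.adjugate 1 0).coeff 0 = 0
    rw [adjugate_fin_two]
    simpa using hM

theorem mem_Gamma {M : SL2 𝔽[X]} : M ∈ Gamma ↔ (M 1 0).coeff 0 = 0 := Iff.rfl

theorem X_mul_divX {p : 𝔽[X]} (h : p.coeff 0 = 0) : X * p.divX = p := by
  have := X_mul_divX_add p
  rwa [h, map_zero, add_zero] at this

/-- The upper unitriangular matrices in `Gamma`. -/
noncomputable def gammaUpper : Multiplicative 𝔽[X] →* Gamma :=
  upper.codRestrict Gamma fun _ => by simp [mem_Gamma]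

/-- The lower unitriangular matrices in `Gamma`, parametrised by `f ↦ lower (X * f)`. -/
noncomputable def gammaLower : Multiplicative 𝔽[X] →* Gamma :=
  (lower.comp (AddMonoidHom.toMultiplicative (AddMonoidHom.mulLeft (X : 𝔽[X])))).codRestrict Gamma
    fun _ => by simp [mem_Gamma]

theorem coe_gammaUpper (f : Multiplicative 𝔽[X]) : (gammaUpper f : SL2 𝔽[X]) = upper f := rfl

theorem coe_gammaLower (f : Multiplicative 𝔽[X]) :
    (gammaLower f : SL2 𝔽[X]) = lower (.ofAdd (X * f.toAdd)) := rfl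

/-- `Gamma` is generated by its unitriangular matrices, by the Euclidean algorithm on the first
column, in which the lower entry stays divisible by `X`. -/
theorem gammaUpper_sup_gammaLower : gammaUpper.range ⊔ gammaLower.range = ⊤ := by
  rw [eq_top_iff]
  set K := gammaUpper.range ⊔ gammaLower.range
  have hu (q : Multiplicative 𝔽[X]) : gammaUpper q ∈ K := Subgroup.mem_sup_left ⟨_, rfl⟩
  have hl (q : Multiplicative 𝔽[X]) : gammaLower q ∈ K := Subgroup.mem_sup_right ⟨_, rfl⟩
  suffices h : ∀ n (M : Gamma), (M.1 0 0).natDegree + (M.1 1 0).natDegree < n → M ∈ K from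
    fun M _ => h _ M (Nat.lt_succ_self _)
  intro n
  induction n with
  | zero => intro M h; omega
  | succ n ih =>
    intro M hM
    have hd := det_eq M.1
    have hc0 : (M.1 1 0).coeff 0 = 0 := M.2
    have ha : M.1 0 0 ≠ 0 := by
      intro h
      have := congrArg (coeff · 0) hd
      simp [h, hc0] at this
    by_cases hc : M.1 1 0 = 0
    · rw [hc, mul_zero, sub_zero] at hd
      have : M = gammaUpper (.ofAdd (M.1 0 1)) := Subtype.ext <|
        ext' (eq_one_of_mul_eq_one hd) rfl hc
          (eq_one_of_mul_eq_one (d := M.1 0 0) (by rw [mul_comm]; exact hd))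
      rw [this]
      exact hu _
    rcases le_or_gt (M.1 1 0).natDegree (M.1 0 0).natDegree with h | h
    · rw [← K.mul_mem_cancel_left (hu (.ofAdd (-(M.1 0 0 / M.1 1 0))))]
      apply ih
      have e0 : (gammaUpper (.ofAdd (-(M.1 0 0 / M.1 1 0))) * M).1 0 0 = M.1 0 0 % M.1 1 0 := by
        rw [Subgroup.coe_mul, coe_gammaUpper, mul_entry, EuclideanDomain.mod_eq_sub_mul_div]
        simp only [upper_zero_zero, upper_zero_one, toAdd_ofAdd]
        ring
      have e1 : (gammaUpper (.ofAdd (-(M.1 0 0 / M.1 1 0))) * M).1 1 0 = M.1 1 0 := by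
        rw [Subgroup.coe_mul, coe_gammaUpper, mul_entry]
        simp [-ofAdd_neg]
      have hc' : (M.1 1 0).natDegree ≠ 0 := by
        intro h0
        rw [eq_C_of_natDegree_eq_zero h0, hc0, map_zero] at hc
        exact hc rfl
      have := natDegree_mod_lt (M.1 0 0) hc'
      rw [e0, e1]
      omega
    · set q := (M.1 1 0).divX / M.1 0 0
      rw [← K.mul_mem_cancel_left (hl (.ofAdd (-q)))]
      apply ih
      have e0 : (gammaLower (.ofAdd (-q)) * M).1 0 0 = M.1 0 0 := by
        rw [Subgroup.coe_mul, coe_gammaLower, mul_entry]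
        simp [-ofAdd_neg]
      have e1 : (gammaLower (.ofAdd (-q)) * M).1 1 0 = X * ((M.1 1 0).divX % M.1 0 0) := by
        rw [Subgroup.coe_mul, coe_gammaLower, mul_entry, EuclideanDomain.mod_eq_sub_mul_div]
        conv_lhs => rw [← X_mul_divX hc0]
        simp only [lower_one_zero, lower_one_one, toAdd_ofAdd]
        ring
      rw [e0, e1]
      have : (X * ((M.1 1 0).divX % M.1 0 0)).natDegree ≤ (M.1 0 0).natDegree := by
        by_cases hr : (M.1 1 0).divX % M.1 0 0 = 0
        · simp [hr]
        · rw [natDegree_X_mul hr]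
          exact natDegree_lt_natDegree hr (EuclideanDomain.mod_lt _ ha)
      omega

theorem gamma_comp_eq :
    gammaUpper.comp (1 : Unit →* Multiplicative 𝔽[X]) =
      gammaLower.comp (1 : Unit →* Multiplicative 𝔽[X]) := by
  rw [MonoidHom.comp_one, MonoidHom.comp_one]

/-- `Gamma` is the free product of its upper and lower unitriangular subgroups. The ping-pong
compares the degrees of the two entries of the first column. -/
theorem gamma_lift_injective :
    Function.Injective (Amalgam.lift gammaUpper gammaLower gamma_comp_eq) := by
  refine Amalgam.lift_injective _ (Function.injective_of_subsingleton _)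
    {M | (M.1 1 0).degree ≤ (M.1 0 0).degree ∧ M ≠ 1} {M | (M.1 0 0).degree < (M.1 1 0).degree}
    ?_ ?_ ?_ ?_ ?_ ?_
  · intro u hu
    refine ⟨by simp [coe_gammaUpper], fun h => hu ⟨1, ?_⟩⟩
    rw [map_one]
    have h' : upper u = upper 1 := (congrArg Subtype.val h).trans (map_one upper).symm
    exact (upper_injective h').symm
  · intro u hu
    have hu' : u.toAdd ≠ 0 := fun h => hu ⟨1, by rw [map_one]; exact h.symm⟩
    simp only [Set.mem_ofPred_eq, coe_gammaLower, lower_zero_zero, lower_one_zero, toAdd_ofAdd,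
      degree_one, degree_mul, degree_X, degree_eq_natDegree hu']
    norm_cast
    omega
  · intro u hu M hM
    have hu' : u.toAdd ≠ 0 := fun h => hu ⟨1, by rw [map_one]; exact h.symm⟩
    have hM : (M.1 0 0).degree < (M.1 1 0).degree := hM
    have e1 : (gammaUpper u * M).1 1 0 = M.1 1 0 := by
      rw [Subgroup.coe_mul, coe_gammaUpper, mul_entry]
      simp
    have hlt : (M.1 1 0).degree ≤ (u.toAdd * M.1 1 0).degree :=
      by
      rw [mul_comm]
      exact degree_le_mul_left _ hu'
    refine ⟨?_, fun h => ?_⟩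
    · rw [e1, Subgroup.coe_mul, coe_gammaUpper, mul_entry, upper_zero_zero, one_mul, upper_zero_one,
        degree_add_eq_right_of_degree_lt (hM.trans_le hlt)]
      exact hlt
    · rw [h] at e1
      rw [← e1] at hM
      simp at hM
  · rintro u hu M ⟨hM, -⟩
    have hu' : u.toAdd ≠ 0 := fun h => hu ⟨1, by rw [map_one]; exact h.symm⟩
    have ha : M.1 0 0 ≠ 0 := by
      intro h
      have hd := det_eq M.1
      rw [h, degree_zero, le_bot_iff, degree_eq_bot] at hM
      simp [h, hM] at hd
    have e0 : (gammaLower u * M).1 0 0 = M.1 0 0 := by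
      rw [Subgroup.coe_mul, coe_gammaLower, mul_entry]
      simp
    have hlt : (M.1 0 0).degree < (X * u.toAdd * M.1 0 0).degree := by
      rw [degree_mul, degree_mul, degree_X, degree_eq_natDegree hu', degree_eq_natDegree ha]
      norm_cast
      omega
    rw [Set.mem_ofPred_eq, e0, Subgroup.coe_mul, coe_gammaLower, mul_entry, lower_one_zero,
      lower_one_one, one_mul, toAdd_ofAdd, degree_add_eq_left_of_degree_lt (hM.trans_lt hlt)]
    exact hlt
  · exact fun h => h.2 rfl
  · intro h
    simp at h

end Congruence

/-! ### The decomposition of `SL₂(𝔽₂[t, t⁻¹])` -/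

section Laurent

open LaurentPolynomial

/-- Conjugation by `!![0, 1; X, 0]` on `Gamma`, with values in `SL₂(𝔽₂[X])`. -/
noncomputable def gammaTwist : Gamma →* SL2 𝔽[X] where
  toFun M := mk (M.1 1 1) (M.1 1 0).divX (X * M.1 0 1) (M.1 0 0) (by
    rw [mul_left_comm, ← mul_assoc, X_mul_divX M.2, mul_comm (M.1 1 1), mul_comm (M.1 1 0)]
    exact det_eq M.1)
  map_one' := by apply ext' <;> simp
  map_mul' M N := by
    have hM := X_mul_divX M.2
    have hN := X_mul_divX N.2
    have hMN := X_mul_divX (M * N).2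
    rw [Subgroup.coe_mul, mul_entry] at hMN
    apply ext'
    · simp only [mk_zero_zero, mk_zero_one, mul_entry, Subgroup.coe_mul, mk_one_zero]
      linear_combination -N.1 0 1 * hM
    · apply mul_left_cancel₀ (X_ne_zero (R := 𝔽))
      simp only [mk_zero_zero, mk_zero_one, mul_entry, Subgroup.coe_mul, mk_one_one]
      linear_combination hMN - N.1 0 0 * hM - M.1 1 1 * hN
    · simp only [mk_zero_zero, mk_one_one, mul_entry, Subgroup.coe_mul, mk_one_zero]
      ring
    · simp only [mk_zero_one, mk_one_one, mul_entry, Subgroup.coe_mul, mk_one_zero]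
      linear_combination -M.1 0 1 * hN

theorem gammaTwist_injective : Function.Injective gammaTwist := by
  intro M N h
  have h' (i j) : gammaTwist M i j = gammaTwist N i j := by rw [h]
  refine Subtype.ext (ext' (h' 1 1) ?_ ?_ (h' 0 0))
  · exact mul_left_cancel₀ (X_ne_zero (R := 𝔽)) (h' 1 0)
  · rw [← X_mul_divX M.2, ← X_mul_divX N.2]
    exact congrArg (X * ·) (h' 0 1)

/-- The range of `gammaTwist` is `Gamma`. -/
theorem coeff_ne_zero_of_notMem_range {g : SL2 𝔽[X]} (hg : g ∉ gammaTwist.range) :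
    (g 1 0).coeff 0 ≠ 0 := by
  intro h
  have hd := det_eq g
  refine hg ⟨⟨mk (g 1 1) (g 1 0).divX (X * g 0 1) (g 0 0) ?_, ?_⟩, ?_⟩
  · linear_combination hd - g 0 1 * X_mul_divX h
  · simp [mem_Gamma]
  · apply ext'
    · rfl
    · change (X * g 0 1).divX = _
      apply mul_left_cancel₀ (X_ne_zero (R := 𝔽))
      rw [X_mul_divX (by simp)]
    · exact X_mul_divX h
    · rfl

theorem T_neg_one_mul_T_one : (T (-1) : 𝔽[T;T⁻¹]) * T 1 = 1 := by
  rw [← T_add]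
  simp

/-- The inclusion `SL₂(𝔽₂[t]) → SL₂(𝔽₂[t, t⁻¹])`. -/
noncomputable def toLaurentSL : SL2 𝔽[X] →* SL2 𝔽[T;T⁻¹] := SpecialLinearGroup.map toLaurent

/-- The inclusion `SL₂(𝔽₂[t]) → SL₂(𝔽₂[t, t⁻¹])` followed by conjugation by `!![0, 1; t, 0]`. -/
noncomputable def twistedLaurentSL : SL2 𝔽[X] →* SL2 𝔽[T;T⁻¹] where
  toFun M := mk (toLaurent (M 1 1)) (T (-1) * toLaurent (M 1 0)) (T 1 * toLaurent (M 0 1))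
    (toLaurent (M 0 0)) (by
      have := congrArg toLaurent (det_eq M)
      rw [map_sub, map_mul, map_mul, map_one] at this
      linear_combination this - toLaurent (M 0 1) * toLaurent (M 1 0) * T_neg_one_mul_T_one)
  map_one' := by apply ext' <;> simp
  map_mul' M N := by
    apply ext'
    · simp only [mk_zero_zero, mk_zero_one, mul_entry, mk_one_zero, map_add, map_mul]
      linear_combination -toLaurent (M 1 0) * toLaurent (N 0 1) * T_neg_one_mul_T_one
    · simp only [mk_zero_zero, mk_zero_one, mul_entry, mk_one_one, map_add, map_mul]
      ring
    · simp only [mk_zero_zero, mk_one_one, mul_entry, mk_one_zero, map_add, map_mul]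
      ring
    · simp only [mk_zero_one, mk_one_one, mul_entry, mk_one_zero, map_add, map_mul]
      linear_combination -toLaurent (M 0 1) * toLaurent (N 1 0) * T_neg_one_mul_T_one

theorem toLaurentSL_entry (M : SL2 𝔽[X]) (i j : Fin 2) :
    toLaurentSL M i j = toLaurent (M i j) := rfl

section

variable (M : SL2 𝔽[X])

theorem twistedLaurentSL_zero_zero : twistedLaurentSL M 0 0 = toLaurent (M 1 1) := rfl
theorem twistedLaurentSL_zero_one :
    twistedLaurentSL M 0 1 = T (-1) * toLaurent (M 1 0) := rfl
theorem twistedLaurentSL_one_zero : twistedLaurentSL M 1 0 = T 1 * toLaurent (M 0 1) := rfl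
theorem twistedLaurentSL_one_one : twistedLaurentSL M 1 1 = toLaurent (M 0 0) := rfl

end

theorem toLaurentSL_comp_subtype :
    toLaurentSL.comp Gamma.subtype = twistedLaurentSL.comp gammaTwist := by
  refine MonoidHom.ext fun M => ext' rfl ?_ ?_ rfl
  · change toLaurent (M.1 0 1) = T (-1) * toLaurent (X * M.1 0 1)
    rw [map_mul, toLaurent_X, ← mul_assoc, T_neg_one_mul_T_one, one_mul]
  · change toLaurent (M.1 1 0) = T 1 * toLaurent (M.1 1 0).divX
    rw [← toLaurent_X, ← map_mul, X_mul_divX M.2]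

theorem toLaurentSL_injective : Function.Injective toLaurentSL := by
  intro M N h
  have key (i j) : M i j = N i j :=
    toLaurent_injective (congrArg (fun M : SL2 𝔽[T;T⁻¹] => M i j) h)
  exact ext' (key _ _) (key _ _) (key _ _) (key _ _)

/-- The diagonal matrices `diag(tⁿ, t⁻ⁿ)`. -/
noncomputable def diagT : Multiplicative ℤ →* SL2 𝔽[T;T⁻¹] where
  toFun n := mk (T n.toAdd) 0 0 (T (-n.toAdd)) (by rw [← T_add]; simp)
  map_one' := by apply ext' <;> simp
  map_mul' m n := by
    apply ext'
    · simp only [mul_entry, mk_zero_zero, mk_one_zero, mul_zero, add_zero, toAdd_mul, T_add]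
    · simp [mul_entry]
    · simp [mul_entry]
    · simp only [mul_entry, mk_one_one, mk_one_zero, zero_mul, zero_add, toAdd_mul, neg_add, T_add]

/-- `SL₂(𝔽₂[t, t⁻¹])` is generated by the two copies of `SL₂(𝔽₂[t])`: they generate all
`diag(tⁿ, t⁻ⁿ)`, hence all upper unitriangular matrices, and the Euclidean algorithm applies after
scaling the first column by a power of `t`. -/
theorem toLaurentSL_sup_twistedLaurentSL : toLaurentSL.range ⊔ twistedLaurentSL.range = ⊤ := by
  rw [eq_top_iff]
  intro M _
  set K := toLaurentSL.range ⊔ twistedLaurentSL.range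
  have hu (q : 𝔽[X]) : upper (.ofAdd (toLaurent q)) ∈ K :=
    Subgroup.mem_sup_left ⟨upper (.ofAdd q), map_upper _ q⟩
  have hw : weyl 𝔽[T;T⁻¹] ∈ K := Subgroup.mem_sup_left ⟨weyl _, map_weyl _⟩
  have hneg := neg_eq_self (LaurentPolynomial.C : 𝔽 →+* 𝔽[T;T⁻¹])
  have hdiag (n : ℤ) : diagT (.ofAdd n) ∈ K := by
    have h1 : diagT (.ofAdd 1) ∈ K := by
      have : diagT (.ofAdd 1) = weyl _ * twistedLaurentSL (weyl _) := by
        apply ext' <;> simp [mul_entry, diagT, twistedLaurentSL, hneg]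
      rw [this]
      exact K.mul_mem hw (Subgroup.mem_sup_right ⟨_, rfl⟩)
    have : (Multiplicative.ofAdd n) = (.ofAdd 1) ^ n := by
      rw [← ofAdd_zsmul]
      simp
    rw [this, map_zpow]
    exact K.zpow_mem h1 n
  have hupper (f : 𝔽[T;T⁻¹]) : upper (.ofAdd f) ∈ K := by
    obtain ⟨n, f', hf⟩ := exists_T_pow f
    have : diagT (.ofAdd (n : ℤ)) * upper (.ofAdd f) =
        upper (.ofAdd (toLaurent (f' * X ^ n))) * diagT (.ofAdd (n : ℤ)) := by
      apply ext'
      · simp [mul_entry, diagT]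
      · simp only [mul_entry, diagT, map_mul, hf, toLaurent_X_pow]
        simp only [MonoidHom.coe_mk, OneHom.coe_mk, mk_zero_zero, mk_zero_one, mk_one_one,
          upper_zero_one, upper_one_one, upper_zero_zero, toAdd_ofAdd]
        have : (T n : 𝔽[T;T⁻¹]) * T (-n) = 1 := by rw [← T_add]; simp
        linear_combination -f * T n * this
      · simp [mul_entry, diagT]
      · simp [mul_entry, diagT]
    rw [← K.mul_mem_cancel_left (hdiag n), this]
    exact K.mul_mem (hu _) (hdiag n)
  obtain ⟨n, a, ha⟩ := exists_T_pow (M 0 0)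
  obtain ⟨m, c, hc⟩ := exists_T_pow (M 1 0)
  obtain ⟨k, hk, hkM⟩ := exists_mul_one_zero_eq_zero hneg toLaurent K hu hw (T (-(n + m)))
    (c * X ^ n) (a * X ^ m) M
    (by
      rw [map_mul, ha, toLaurent_X_pow, mul_assoc, ← T_add, mul_comm, mul_assoc, ← T_add]
      simp)
    (by
      rw [map_mul, hc, toLaurent_X_pow, mul_assoc, ← T_add, mul_comm, mul_assoc, ← T_add]
      rw [show (m + n + -(n + m) : ℤ) = 0 by ring, T_zero, mul_one])
  rw [← K.mul_mem_cancel_left hk]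
  generalize k * M = N at hkM
  have hd := det_eq N
  rw [hkM, mul_zero, sub_zero] at hd
  -- The diagonal entries are units, hence powers of `t`.
  obtain ⟨j, hj⟩ : ∃ j : ℤ, N 0 0 = T j := by
    obtain ⟨n, a, ha⟩ := exists_T_pow (N 0 0)
    obtain ⟨m, d, hd'⟩ := exists_T_pow (N 1 1)
    have hX : a * d = X ^ (n + m) := by
      apply toLaurent_injective
      rw [map_mul, ha, hd', toLaurent_X_pow, Nat.cast_add, T_add]
      linear_combination T n * T m * hd
    obtain ⟨i, -, u, hi⟩ := (dvd_prime_pow prime_X _).1 (Dvd.intro _ hX)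
    have hu1 : (u : 𝔽[X]) = 1 := eq_one_of_mul_eq_one u.mul_inv
    rw [hu1, mul_one] at hi
    refine ⟨i - n, ?_⟩
    rw [hi, toLaurent_X_pow] at ha
    rw [T_sub, ha, mul_assoc, ← T_add]
    simp
  have hj' : N 1 1 = T (-j) := by
    rw [hj] at hd
    have : (T j : 𝔽[T;T⁻¹]) * T (-j) = 1 := by rw [← T_add]; simp
    linear_combination T (-j) * hd - N 1 1 * this
  have : N = diagT (.ofAdd j) * upper (.ofAdd (T (-j) * N 0 1)) := by
    apply ext'
    · simp [mul_entry, diagT, hj]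
    · simp [mul_entry, diagT, ← mul_assoc]
    · simp [mul_entry, diagT, hkM]
    · simp [mul_entry, diagT, hj']
  rw [this]
  exact K.mul_mem (hdiag j) (hupper _)

theorem eq_zero_of_T_mul_eq_zero {n : ℤ} {q : 𝔽[X]} (h : T n * toLaurent q = 0) : q = 0 := by
  rw [← toLaurent_eq_zero]
  exact (isUnit_T n).mul_right_eq_zero.1 h

theorem coeff_zero_of_T_mul_eq_one {n : ℤ} (hn : n < 0) {q : 𝔽[X]}
    (h : 1 = T n * toLaurent q) : q.coeff 0 = 0 := by
  obtain ⟨k, rfl⟩ : ∃ k : ℕ, n = -(k + 1 : ℕ) := ⟨(-n - 1).toNat, by omega⟩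
  have : q = X ^ (k + 1) := by
    apply toLaurent_injective
    rw [toLaurent_X_pow]
    have h1 : (T (k + 1 : ℕ) : 𝔽[T;T⁻¹]) * T (-(k + 1 : ℕ)) = 1 := by rw [← T_add]; simp
    linear_combination T (k + 1 : ℕ) * (-h) - toLaurent q * h1
  simp [this]

/-- `SL₂(𝔽₂[t, t⁻¹])` is the amalgam over `Gamma` of `SL₂(𝔽₂[t])` and its conjugate by
`!![0, 1; t, 0]`. The ping-pong compares the `t`-adic orders of the two entries of a column. -/
theorem laurent_lift_injective :
    Function.Injective (Amalgam.lift toLaurentSL twistedLaurentSL toLaurentSL_comp_subtype) := by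
  have hT (n : ℤ) : (T n : 𝔽[T;T⁻¹]) = T (n - 1) * T 1 := by rw [← T_add]; simp
  refine Amalgam.lift_injective _ (toLaurentSL_injective.comp Gamma.subtype_injective)
    -- The order of `M 1 j` is `n`, at most that of `M 0 j`; order zero occurs in the first column
    -- only, since the second column of `1` has to be excluded.
    {M | ∃ (j : Fin 2) (n : ℤ) (p q : 𝔽[X]), M 0 j = T n * toLaurent p ∧
      M 1 j = T n * toLaurent q ∧ q.coeff 0 ≠ 0 ∧ (n < 0 ∨ n = 0 ∧ j = 0)}
    -- The order of `M 0 j` is `n < 0`, less than that of `M 1 j`.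
    {M | ∃ (j : Fin 2) (n : ℤ) (p q : 𝔽[X]), M 0 j = T n * toLaurent p ∧
      M 1 j = T n * toLaurent (X * q) ∧ p.coeff 0 ≠ 0 ∧ n < 0}
    ?_ ?_ ?_ ?_ ?_ ?_
  · intro g hg
    have hg : (g 1 0).coeff 0 ≠ 0 := fun h => hg ⟨⟨g, h⟩, rfl⟩
    exact ⟨0, 0, g 0 0, g 1 0, by simp [toLaurentSL_entry], by simp [toLaurentSL_entry], hg,
      .inr ⟨rfl, rfl⟩⟩
  · intro g hg
    refine ⟨1, -1, g 1 0, g 0 0, rfl, ?_, coeff_ne_zero_of_notMem_range hg, by decide⟩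
    rw [twistedLaurentSL_one_one, map_mul, toLaurent_X, ← mul_assoc, T_neg_one_mul_T_one, one_mul]
  · rintro g hg M ⟨j, n, p, q, hp, hq, hp0, hn⟩
    have hg : (g 1 0).coeff 0 ≠ 0 := fun h => hg ⟨⟨g, h⟩, rfl⟩
    refine ⟨j, n, g 0 0 * p + g 0 1 * (X * q), g 1 0 * p + g 1 1 * (X * q), ?_, ?_, ?_, .inl hn⟩
    · rw [mul_entry, toLaurentSL_entry, toLaurentSL_entry, hp, hq]
      simp only [map_add, map_mul]
      ring
    · rw [mul_entry, toLaurentSL_entry, toLaurentSL_entry, hp, hq]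
      simp only [map_add, map_mul]
      ring
    · simpa using ⟨hg, hp0⟩
  · rintro g hg M ⟨j, n, p, q, hp, hq, hq0, hn⟩
    have hg := coeff_ne_zero_of_notMem_range hg
    refine ⟨j, n - 1, X * (g 1 1 * p) + g 1 0 * q, X * (g 0 1 * p) + g 0 0 * q, ?_, ?_, ?_, ?_⟩
    · rw [mul_entry, twistedLaurentSL_zero_zero, twistedLaurentSL_zero_one, hp, hq, hT n]
      simp only [map_add, map_mul, toLaurent_X]
      linear_combination T (n - 1) * toLaurent (g 1 0) * toLaurent q * T_neg_one_mul_T_one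
    · rw [mul_entry, twistedLaurentSL_one_zero, twistedLaurentSL_one_one, hp, hq, hT n]
      simp only [map_add, map_mul, toLaurent_X]
      ring
    · simpa using ⟨hg, hq0⟩
    · omega
  · rintro ⟨j, n, p, q, -, hq, hq0, hn⟩
    fin_cases j
    · exact hq0 (by rw [eq_zero_of_T_mul_eq_zero (Eq.symm hq), coeff_zero])
    · exact hq0 (coeff_zero_of_T_mul_eq_one (by simpa using hn) hq)
  · rintro ⟨j, n, p, q, hp, -, hp0, hn⟩
    fin_cases j
    · exact hp0 (coeff_zero_of_T_mul_eq_one hn hp)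
    · exact hp0 (by rw [eq_zero_of_T_mul_eq_zero (Eq.symm hp), coeff_zero])

/-! ### The central extension of `SL₂(𝔽₂[t, t⁻¹])` -/

/-- The extension of `Gamma ≅ 𝔽₂[X] * 𝔽₂[X]` assembled from the Heisenberg extension of each free
factor. -/
abbrev GammaExt : Type := Amalgam (Heis.inl (F := 𝔽)) (Heis.inl (F := 𝔽))

/-- The projection of `GammaExt` to `Gamma`. -/
noncomputable def gammaExtProj : GammaExt →* Gamma :=
  Amalgam.lift (gammaUpper.comp Heis.proj) (gammaLower.comp Heis.proj) <|
    MonoidHom.ext fun _ => (map_one gammaUpper).trans (map_one gammaLower).symm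

theorem isCentralExtension_gammaExtProj :
    IsCentralExtension (Amalgam.inl.comp Heis.inl) gammaExtProj := by
  have e₀ : IsCentralExtension (MonoidHom.id (Multiplicative (ℕ → 𝔽)))
      (1 : Multiplicative (ℕ → 𝔽) →* Unit) :=
    ⟨fun _ _ h => h, fun _ => ⟨1, rfl⟩, fun x => ⟨fun _ => ⟨x, rfl⟩, fun _ => rfl⟩,
      fun a b => mul_comm a b⟩
  refine e₀.amalgam Heis.isCentralExtension Heis.isCentralExtension
    (φ₁ := 1) (φ₂ := 1) (Function.injective_of_subsingleton _)
    (Function.injective_of_subsingleton _)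
    rfl rfl rfl rfl gamma_comp_eq gamma_lift_injective gammaUpper_sup_gammaLower ?_ ?_
  · exact fun x => Amalgam.lift_inl ..
  · exact fun x => Amalgam.lift_inr ..

/-- The extension of `SL₂(𝔽₂[X]) ≅ SL₂(𝔽₂) *_{𝔽₂} 𝔽₂[X]` that is split over `SL₂(𝔽₂)` and
the Heisenberg extension over `𝔽₂[X]`. -/
abbrev PolyExt : Type :=
  Amalgam ((MonoidHom.id (Multiplicative (ℕ → 𝔽))).prodMap (upper (R := 𝔽))) Heis.ofConst

/-- The projection of `PolyExt` to `SL₂(𝔽₂[X])`. -/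
noncomputable def polyExtProj : PolyExt →* SL2 𝔽[X] :=
  Amalgam.lift ((SpecialLinearGroup.map (Polynomial.C : 𝔽 →+* 𝔽[X])).comp (MonoidHom.snd _ _))
    (upper.comp Heis.proj) <| MonoidHom.ext fun x => map_upper _ x.2.toAdd

theorem polyExtProj_inl (x : Multiplicative (ℕ → 𝔽) × SL2 𝔽) :
    polyExtProj (Amalgam.inl x) = SpecialLinearGroup.map Polynomial.C x.2 :=
  Amalgam.lift_inl ..

theorem polyExtProj_inr (x : Heis 𝔽) :
    polyExtProj (Amalgam.inr x) = upper (.ofAdd x.poly) :=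
  Amalgam.lift_inr ..

/-- The inclusion of the central subgroup of `PolyExt`. -/
noncomputable def polyExtInl : Multiplicative (ℕ → 𝔽) →* PolyExt :=
  Amalgam.inl.comp (MonoidHom.inl _ _)

theorem isCentralExtension_prod {A G : Type} [CommGroup A] [Group G] :
    IsCentralExtension (MonoidHom.inl A G) (MonoidHom.snd A G) where
  injective _ _ h := congrArg Prod.fst h
  surjective g := ⟨(1, g), rfl⟩
  apply_eq_one_iff x := ⟨fun h => ⟨x.1, Prod.ext rfl h.symm⟩, by rintro ⟨a, rfl⟩; rfl⟩
  commute a x := Prod.ext (mul_comm _ _) ((one_mul _).trans (mul_one _).symm)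

theorem isCentralExtension_polyExtProj : IsCentralExtension polyExtInl polyExtProj := by
  have h₁ : ((MonoidHom.id (Multiplicative (ℕ → 𝔽))).prodMap (upper (R := 𝔽))).comp
      (MonoidHom.inl _ _) = MonoidHom.inl _ _ :=
    MonoidHom.ext fun a => Prod.ext rfl (map_one (upper (R := 𝔽)))
  have h₂ : (Heis.ofConst (F := 𝔽)).comp (MonoidHom.inl _ _) = Heis.inl :=
    MonoidHom.ext fun a => Heis.ext (map_zero (Polynomial.C (R := 𝔽))) rfl
  have h₃ : (MonoidHom.snd (Multiplicative (ℕ → 𝔽)) (SL2 𝔽)).comp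
      ((MonoidHom.id (Multiplicative (ℕ → 𝔽))).prodMap upper) =
        upper.comp (MonoidHom.snd _ _) := rfl
  have h₄ : (Heis.proj (F := 𝔽)).comp Heis.ofConst =
      (AddMonoidHom.toMultiplicative (Polynomial.C : 𝔽 →+* 𝔽[X]).toAddMonoidHom).comp
        (MonoidHom.snd _ _) := rfl
  have := IsCentralExtension.amalgam isCentralExtension_prod isCentralExtension_prod
    Heis.isCentralExtension upper_injective constants_injective h₁ h₂ h₃ h₄ constants_comp_upper
    constants_upper_lift_injective constants_sup_upper (p := polyExtProj)
  exact this polyExtProj_inl polyExtProj_inr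

theorem inr_inl_eq_polyExtInl (a : Multiplicative (ℕ → 𝔽)) :
    (Amalgam.inr (Heis.inl a) : PolyExt) = polyExtInl a := by
  have h : Heis.ofConst (a, 1) = Heis.inl a := Heis.ext (map_zero Polynomial.C) rfl
  rw [← h, ← Amalgam.inl_apply_eq_inr_apply]
  simp [polyExtInl]

/-- A lift of the Weyl element to `PolyExt`. -/
noncomputable def weylLift : PolyExt := Amalgam.inl (1, weyl 𝔽)

/-- A lift of `f ↦ lower (X * f)` to the extensions, obtained by conjugating the shifted Heisenberg
group by `weylLift`. -/
noncomputable def lowerLift : Heis 𝔽 →* PolyExt :=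
  (MulAut.conj weylLift).toMonoidHom.comp (Amalgam.inr.comp Heis.shift)

theorem lowerLift_inl (a : Multiplicative (ℕ → 𝔽)) :
    lowerLift (Heis.inl a) = Amalgam.inr (Heis.inl a) := by
  have h : Heis.shift (Heis.inl a) = Heis.inl a := by ext1 <;> simp
  change weylLift * Amalgam.inr (Heis.shift (Heis.inl a)) * weylLift⁻¹ = _
  rw [h, inr_inl_eq_polyExtInl, ← (isCentralExtension_polyExtProj.commute a _).eq,
    mul_inv_cancel_right]

theorem polyExtProj_lowerLift (x : Heis 𝔽) :
    polyExtProj (lowerLift x) = lower (.ofAdd (X * x.poly)) := by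
  change polyExtProj (weylLift * Amalgam.inr (Heis.shift x) * weylLift⁻¹) = _
  rw [map_mul, map_mul, map_inv, polyExtProj_inr, weylLift, polyExtProj_inl, map_weyl,
    weyl_mul_upper, mul_inv_cancel_right, neg_eq_self Polynomial.C]
  rfl

/-- The lift of the inclusion `Gamma → SL₂(𝔽₂[X])` to the extensions. -/
noncomputable def gammaExtHom : GammaExt →* PolyExt :=
  Amalgam.lift Amalgam.inr lowerLift <| MonoidHom.ext fun a => (lowerLift_inl a).symm

/-- The lift of `gammaTwist` to the extensions: the twist exchanges the two free factors. -/
noncomputable def gammaExtTwist : GammaExt →* PolyExt :=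
  Amalgam.lift lowerLift Amalgam.inr <| MonoidHom.ext lowerLift_inl

theorem polyExtProj_comp_gammaExtHom :
    polyExtProj.comp gammaExtHom = Gamma.subtype.comp gammaExtProj := by
  refine Amalgam.hom_ext (fun x => ?_) (fun x => ?_)
  · simp only [MonoidHom.comp_apply, gammaExtHom, gammaExtProj, Amalgam.lift_inl, polyExtProj_inr]
    rfl
  · simp only [MonoidHom.comp_apply, gammaExtHom, gammaExtProj, Amalgam.lift_inr,
      polyExtProj_lowerLift]
    rfl

theorem polyExtProj_comp_gammaExtTwist :
    polyExtProj.comp gammaExtTwist = gammaTwist.comp gammaExtProj := by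
  refine Amalgam.hom_ext (fun x => ?_) (fun x => ?_)
  · simp only [MonoidHom.comp_apply, gammaExtTwist, gammaExtProj, Amalgam.lift_inl,
      polyExtProj_lowerLift]
    apply ext' <;> simp [gammaTwist, coe_gammaUpper]
  · simp only [MonoidHom.comp_apply, gammaExtTwist, gammaExtProj, Amalgam.lift_inr,
      polyExtProj_inr]
    have h : (X * x.poly).divX = x.poly :=
      mul_left_cancel₀ (X_ne_zero (R := 𝔽)) (X_mul_divX (by simp))
    apply ext' <;> simp [gammaTwist, coe_gammaLower, h]

/-- The central extension of `SL₂(𝔽₂[t, t⁻¹])` glued from two copies of `PolyExt` along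
`GammaExt`. -/
abbrev LaurentExt : Type := Amalgam gammaExtHom gammaExtTwist

/-- The projection of `LaurentExt` to `SL₂(𝔽₂[t, t⁻¹])`. -/
noncomputable def laurentExtProj : LaurentExt →* SL2 𝔽[T;T⁻¹] :=
  Amalgam.lift (toLaurentSL.comp polyExtProj) (twistedLaurentSL.comp polyExtProj) <| by
    rw [MonoidHom.comp_assoc, MonoidHom.comp_assoc, polyExtProj_comp_gammaExtHom,
      polyExtProj_comp_gammaExtTwist, ← MonoidHom.comp_assoc, ← MonoidHom.comp_assoc,
      toLaurentSL_comp_subtype]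

theorem isCentralExtension_laurentExtProj :
    IsCentralExtension (Amalgam.inl.comp polyExtInl) laurentExtProj := by
  refine isCentralExtension_gammaExtProj.amalgam isCentralExtension_polyExtProj
    isCentralExtension_polyExtProj Gamma.subtype_injective gammaTwist_injective
    (MonoidHom.ext fun a => ?_) (MonoidHom.ext fun a => ?_) polyExtProj_comp_gammaExtHom
    polyExtProj_comp_gammaExtTwist toLaurentSL_comp_subtype laurent_lift_injective
    toLaurentSL_sup_twistedLaurentSL ?_ ?_
  · change gammaExtHom (Amalgam.inl (Heis.inl a)) = polyExtInl a
    rw [gammaExtHom, Amalgam.lift_inl, inr_inl_eq_polyExtInl]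
  · change gammaExtTwist (Amalgam.inl (Heis.inl a)) = polyExtInl a
    rw [gammaExtTwist, Amalgam.lift_inl, lowerLift_inl, inr_inl_eq_polyExtInl]
  · exact fun x => Amalgam.lift_inl ..
  · exact fun x => Amalgam.lift_inr ..

/-- A lift of `upper f` to `LaurentExt`, for a polynomial `f`. -/
noncomputable def upperLift (f : 𝔽[X]) : LaurentExt := Amalgam.inl (Amalgam.inr ⟨f, 0⟩)

theorem laurentExtProj_upperLift (f : 𝔽[X]) :
    laurentExtProj (upperLift f) = upper (.ofAdd (toLaurent f)) := by
  refine (Amalgam.lift_inl ..).trans ?_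
  rw [MonoidHom.comp_apply, polyExtProj_inr]
  exact map_upper _ _

theorem upperLift_one_mul_upperLift_X_pow (n : ℕ) :
    upperLift 1 * upperLift (X ^ (n + 1)) =
      Amalgam.inl (polyExtInl (.ofAdd (Pi.single n 1))) *
        (upperLift (X ^ (n + 1)) * upperLift 1) := by
  simp only [upperLift]
  rw [← map_mul, ← map_mul, Heis.one_mul_X_pow, map_mul, map_mul, inr_inl_eq_polyExtInl, map_mul,
    map_mul]

end Laurent

end SL2

end SL2

/-! ### The second homology of `SL₂(ℤ[t, t⁻¹])` -/

theorem theorem3p1 :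
    ¬ AddGroup.FG
      (groupHomology
        (Rep.trivial ℤ (Matrix.SpecialLinearGroup (Fin 2) (LaurentPolynomial ℤ)) ℤ) 2) := by
  let r : LaurentPolynomial ℤ →+* LaurentPolynomial (ZMod 2) :=
    AddMonoidAlgebra.mapRingHom ℤ (Int.castRingHom (ZMod 2))
  have hr (n : ℤ) : r (LaurentPolynomial.T n) = LaurentPolynomial.T n := by
    refine (AddMonoidAlgebra.mapRingHom_single ..).trans ?_
    rw [map_one]
    rfl
  have hcomm (f g : LaurentPolynomial ℤ) :
      SL2.upper (.ofAdd f) * SL2.upper (.ofAdd g) =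
        SL2.upper (.ofAdd g) * SL2.upper (.ofAdd f) := by
    rw [← map_mul, mul_comm, map_mul]
  refine SL2.isCentralExtension_laurentExtProj.not_fg_H2 (fun a => ?_)
    (Matrix.SpecialLinearGroup.map r)
    (SL2.upper (.ofAdd 1)) (fun n => SL2.upper (.ofAdd (LaurentPolynomial.T (n + 1))))
    (fun n => hcomm _ _)
    (SL2.upperLift 1) (fun n => SL2.upperLift (Polynomial.X ^ (n + 1))) (fun n => Pi.single n 1) ?_
    (fun n => ?_) SL2.upperLift_one_mul_upperLift_X_pow fun m n h => ?_
  · ext n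
    simpa using CharTwo.two_nsmul (a n)
  · rw [SL2.laurentExtProj_upperLift, SL2.map_upper, map_one Polynomial.toLaurent, map_one r]
  · rw [SL2.laurentExtProj_upperLift, SL2.map_upper, hr, Polynomial.toLaurent_X_pow, Nat.cast_succ]
  · by_contra hmn
    have := congrFun h m
    simp [hmn] at this
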